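/- **Conventions.** A *pregeometry* over a set $I$ is a triple $\mathcal G=(X,*,\mathrm{typ})$ with a symmetric, reflexive relation $*$ on $X$ (incidence) and a surjective map $\mathrm{typ}:X\to I$ such that $x*y$ and $\mathrm{typ}(x)=\mathrm{typ}(y)$ imply $x=y$. A *flag* is a set of pairwise incident elements (possibly empty), its type is its image under $\mathrm{typ}$, and a *chamber* is a flag of type $I$; $\mathcal G$ is a *geometry* if every flag is contained in a chamber. The *residue* $\mathcal G_F$ of a flag $F$ is the pregeometry of all $x\in X$ with $\mathrm{typ}(x)\notin\mathrm{typ}(F)$ and $F\cup\{x\}$ a flag, with the restricted incidence and type function. A pregeometry is *simply connected* if its graph $(X,*)$ is nonempty and connected and every cycle $(x_0,\dots,x_k)$, $x_i*x_{i+1}$, $x_k=x_0$, can be transformed into the trivial cycle $(x_0)$ by inserting and deleting cycles of length one, two or three. (In particular the empty residue of a chamber is not simply connected.) A set $W\subseteq X$ is a *hall* if $\mathrm{typ}(W)=I$ and each $V\subseteq W$ on which $\mathrm{typ}$ is injective is a flag. **Theorem.** Let $\mathcal G=(X,*,\mathrm{typ})$ be a geometry over a finite set $I$ and let $G$ be a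 group of (type- and incidence-preserving) automorphisms of $\mathcal G$. Let $W\subseteq X$ consist of exactly one representative of each $G$-orbit on $X$, and suppose that 1. $W$ is a hall, and 2. for each flag $V\subseteq W$, the action of $G$ on the pregeometry over $\mathrm{typ}(V)$ consisting of all elements of the $G$-orbits $G.x$, $x\in V$, is flag-transitive, i.e. $G$ is transitive on the flags of each given type of this pregeometry. Let $\mathcal W\subseteq 2^W$ be a *shape*, i.e. each $U\in\mathcal W$ is a flag, and each flag $U'\subseteq W$ that contains some $U\in\mathcal W$ belongs to $\mathcal W$. For a flag $U\subseteq W$ let $G_U$ be the stabilizer of $U$ in $G$ (so $G_\emptyset=G$). Let $\mathcal A_{\mathcal W}(\mathcal G,G,W)$ be the amalgam $(G_U)_{U\in\mathcal W}$ with the natural inclusions $G_U\hookrightarrow G_V$, $V\subseteq U$, as identifications, and let $\mathcal A(\mathcal G,G,W)$ be the amalgam $(G_U)$, $U$ ranging over all nonempty flags contained in $W$, again with the natural inclusions. The universal completion $\mathcal U(\mathcal A)$ of an amalgam $\mathcal A$ is the group with generators $u_g$, $g$ in the disjoint union of the members of $\mathcal A$, and relations $u_xu_y=u_z$ whenever $xy=z$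 in some member, and $u_x=u_y$ whenever $\phi(x)=y$ for some identification $\phi$. Assume that for each flag $U\subseteq W$ with $U\notin\mathcal W$ the residue $\mathcal G_U$ is simply connected. Then $$G=\mathcal U(\mathcal A_{\mathcal W}(\mathcal G,G,W)),$$ that is, the canonical homomorphism $\mathcal U(\mathcal A_{\mathcal W}(\mathcal G,G,W))\to G$, $u_g\mapsto g$, is an isomorphism. In particular, if $\emptyset\notin\mathcal W$, then $$G=\mathcal U(\mathcal A(\mathcal G,G,W))=\mathcal U(\mathcal A_{\mathcal W}(\mathcal G,G,W)),$$ that is, in addition the canonical homomorphism $\mathcal U(\mathcal A(\mathcal G,G,W))\to G$ is an isomorphism, and there is an isomorphism $\mathcal U(\mathcal A_{\mathcal W}(\mathcal G,G,W))\cong\mathcal U(\mathcal A(\mathcal G,G,W))$ sending the generator $u_g$, $g\in G_U$, to the generator $u_g$, $g\in G_U$, for each $U\in\mathcal W$. -/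

import Mathlib

open scoped Pointwise

/-- A pregeometry over the type set `I` with set of elements `X`. -/
structure Pregeometry (X : Type*) (I : Type*) where
  /-- The incidence relation. -/
  inc : X → X → Prop
  /-- The type function. -/
  typ : X → I
  inc_symm : ∀ x y, inc x y → inc y x
  inc_refl : ∀ x, inc x x
  typ_surjective : Function.Surjective typ
  eq_of_inc_of_typ_eq : ∀ x y, inc x y → typ x = typ y → x = y

namespace Pregeometry

variable {X I : Type*} (𝒢 : Pregeometry X I)

/-- A flag is a set of pairwise incident elements. -/
def IsFlag (F : Set X) : Prop := ∀ x ∈ F, ∀ y ∈ F, 𝒢.inc x y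

/-- A chamber is a flag whose type is the whole type set. -/
def IsChamber (C : Set X) : Prop := 𝒢.IsFlag C ∧ 𝒢.typ '' C = Set.univ

/-- A geometry is a pregeometry in which every flag is contained in a chamber. -/
def IsGeometry : Prop := ∀ F : Set X, 𝒢.IsFlag F → ∃ C : Set X, 𝒢.IsChamber C ∧ F ⊆ C

/-- A lounge is a set of elements each of whose subsets on which the type function is injective
is a flag. -/
def IsLounge (W : Set X) : Prop := ∀ V ⊆ W, Set.InjOn 𝒢.typ V → 𝒢.IsFlag V

/-- A hall is a lounge containing elements of every type. -/
def IsHall (W : Set X) : Prop := 𝒢.IsLounge W ∧ 𝒢.typ '' W = Set.univ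

/-! ### Residues -/

/-- The type set of the residue of `F`. -/
def residueTypes (F : Set X) : Set I :=
  {j | j ∉ 𝒢.typ '' F ∧ ∃ x, 𝒢.typ x = j ∧ 𝒢.IsFlag (insert x F)}

/-- The set of elements of the residue of `F`. -/
def residueElements (F : Set X) : Set X :=
  {x | 𝒢.typ x ∈ 𝒢.residueTypes F ∧ 𝒢.IsFlag (insert x F)}

/-- The residue of `F`, with the incidence relation and the type function restricted. -/
def residue (F : Set X) : Pregeometry (𝒢.residueElements F) (𝒢.residueTypes F) where
  inc x y := 𝒢.inc x y
  typ x := ⟨𝒢.typ x, x.2.1⟩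
  inc_symm x y h := 𝒢.inc_symm x y h
  inc_refl x := 𝒢.inc_refl x
  typ_surjective := by
    rintro ⟨j, hj⟩
    obtain ⟨x, rfl, hx⟩ := hj.2
    exact ⟨⟨x, hj, hx⟩, rfl⟩
  eq_of_inc_of_typ_eq x y h e :=
    Subtype.ext (𝒢.eq_of_inc_of_typ_eq x y h (congrArg Subtype.val e))

/-! ### Connectedness, homotopy of paths, simple connectedness -/

/-- A path `(x₀, …, x_k)` from `x = x₀` to `y = x_k`: a nonempty finite sequence in which
consecutive elements are incident. -/
def IsPath (x y : X) (p : List X) : Prop :=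
  p.IsChain 𝒢.inc ∧ p.head? = some x ∧ p.getLast? = some y

/-- The incidence graph is connected (and, in particular, nonempty). -/
def IsConnected : Prop := Nonempty X ∧ ∀ x y, ∃ p, 𝒢.IsPath x y p

/-- `𝒢.Insertion p q` says that `q` arises from the sequence `p` by inserting, at some position,
a cycle of length one (a repetition), two (a return) or three (a triangle).
The insertion or the deletion of such a cycle turns a path into a path with the same ends. -/
inductive Insertion : List X → List X → Prop
  | repetition (p q : List X) (x : X) :
      Insertion (p ++ x :: q) (p ++ x :: x :: q)
  | backtrack (p q : List X) (x y : X) (hxy : 𝒢.inc x y) :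
      Insertion (p ++ x :: q) (p ++ x :: y :: x :: q)
  | triangle (p q : List X) (x y z : X) (hxy : 𝒢.inc x y) (hyz : 𝒢.inc y z) (hzx : 𝒢.inc z x) :
      Insertion (p ++ x :: q) (p ++ x :: y :: z :: x :: q)

/-- Homotopy of paths: the equivalence relation generated by the elementary homotopies, that is,
by inserting or deleting cycles of length one, two or three. -/
def Homotopic : List X → List X → Prop := Relation.EqvGen 𝒢.Insertion

/-- Simple connectedness: the incidence graph is connected and the fundamental group at any base
point `x` is trivial, i.e. every cycle based at `x` is homotopic to the trivial cycle `(x)`. -/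
def IsSimplyConnected : Prop :=
  𝒢.IsConnected ∧ ∀ x c, 𝒢.IsPath x x c → 𝒢.Homotopic c [x]

/-! ### Automorphisms, transitivity, orbit geometries -/

/-- The automorphism group: the type-preserving permutations of the elements that preserve
incidence in both directions. -/
def Aut : Subgroup (Equiv.Perm X) where
  carrier := {σ | (∀ x, 𝒢.typ (σ x) = 𝒢.typ x) ∧ ∀ x y, 𝒢.inc (σ x) (σ y) ↔ 𝒢.inc x y}
  one_mem' := ⟨fun _ => rfl, fun _ _ => Iff.rfl⟩
  mul_mem' {σ τ} hσ hτ :=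
    ⟨fun x => (hσ.1 (τ x)).trans (hτ.1 x), fun x y => (hσ.2 (τ x) (τ y)).trans (hτ.2 x y)⟩
  inv_mem' {σ} hσ :=
    ⟨fun x => by simpa using (hσ.1 (σ⁻¹ x)).symm,
      fun x y => by simpa using (hσ.2 (σ⁻¹ x) (σ⁻¹ y)).symm⟩

/-- A group acting on the elements is flag-transitive if any two flags of the same type are
exchanged by some group element. -/
def IsFlagTransitive (H : Type*) [Group H] [MulAction H X] : Prop :=
  ∀ c d : Set X, 𝒢.IsFlag c → 𝒢.IsFlag d → 𝒢.typ '' c = 𝒢.typ '' d → ∃ g : H, g • c = d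

variable {𝒢} (G : Subgroup 𝒢.Aut)

theorem typ_smul (g : G) (x : X) : 𝒢.typ (g • x) = 𝒢.typ x := (g : 𝒢.Aut).2.1 x

/-- `W` is a set of representatives of the `G`-orbits: it meets each orbit in exactly one
element. -/
def IsOrbitRepresentatives (W : Set X) : Prop := ∀ x : X, ∃! w, w ∈ W ∧ w ∈ MulAction.orbit G x

/-- The union of the orbits `G.x`, `x ∈ V`, with the action of `G` on it. -/
def orbitElements (V : Set X) : SubMulAction G X where
  carrier := {y | ∃ x ∈ V, y ∈ MulAction.orbit G x}
  smul_mem' g y := by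
    rintro ⟨x, hx, hy⟩
    exact ⟨x, hx, (MulAction.mem_orbit_of_mem_orbit g hy)⟩

/-- The orbit geometry of `V`: the pregeometry over `typ(V)` that consists of all elements of the
orbits `G.x`, `x ∈ V`. -/
def orbitGeometry (V : Set X) : Pregeometry (orbitElements G V) (𝒢.typ '' V) where
  inc x y := 𝒢.inc x y
  typ y := ⟨𝒢.typ y, by
    obtain ⟨_, x, hx, g, rfl⟩ := y
    exact ⟨x, hx, (typ_smul G g x).symm⟩⟩
  inc_symm x y h := 𝒢.inc_symm x y h
  inc_refl x := 𝒢.inc_refl x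
  typ_surjective := by
    rintro ⟨_, x, hx, rfl⟩
    exact ⟨⟨x, x, hx, MulAction.mem_orbit_self x⟩, rfl⟩
  eq_of_inc_of_typ_eq x y h e :=
    Subtype.ext (𝒢.eq_of_inc_of_typ_eq x y h (congrArg Subtype.val e))

end Pregeometry

/-! ### Amalgams and their universal completions -/

/-- A family of groups together with monomorphisms (identifications) between some of its members. -/
structure Amalgam.{u} where
  /-- The index set. -/
  Index : Type u
  /-- The members of the amalgam. -/
  Member : Index → Type u
  [group : ∀ i, Group (Member i)]
  /-- Which pairs of members are linked by an identification. -/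
  Linked : Index → Index → Prop
  /-- The identifications. -/
  ident : ∀ i j, Linked i j → (Member i →* Member j)
  ident_injective : ∀ i j (h : Linked i j), Function.Injective (ident i j h)

namespace Amalgam

attribute [instance] Amalgam.group

variable (A : Amalgam)

/-- The defining relators of the universal completion on the generators `u_g`, `g` in the disjoint
union of the members: `u_x u_y = u_z` whenever `x y = z` in some member, and `u_x = u_y` whenever
`y` is the image of `x` under some identification. -/
inductive IsRelator : FreeGroup (Σ i, A.Member i) → Prop
  | mul (i : A.Index) (x y z : A.Member i) (h : x * y = z) :
      IsRelator (FreeGroup.of ⟨i, x⟩ * FreeGroup.of ⟨i, y⟩ * (FreeGroup.of ⟨i, z⟩)⁻¹)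
  | ident (i j : A.Index) (h : A.Linked i j) (x : A.Member i) (y : A.Member j)
      (hxy : A.ident i j h x = y) :
      IsRelator (FreeGroup.of ⟨i, x⟩ * (FreeGroup.of ⟨j, y⟩)⁻¹)

/-- The group underlying the universal completion, given by generators and relations. -/
abbrev UniversalCompletion : Type _ := PresentedGroup {r | A.IsRelator r}

/-- The universal completion map `g ↦ u_g`. -/
def of (i : A.Index) (g : A.Member i) : A.UniversalCompletion := PresentedGroup.of ⟨i, g⟩

/-- The homomorphism `u_g ↦ f g` from the universal completion to a group `H` that is determined
by a family of homomorphisms `f i` from the members to `H` compatible with the identifications. -/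
def lift {H : Type*} [Group H] (f : ∀ i, A.Member i →* H)
    (hf : ∀ i j (h : A.Linked i j) (x : A.Member i), f j (A.ident i j h x) = f i x) :
    A.UniversalCompletion →* H :=
  PresentedGroup.toGroup (f := fun s : Σ i, A.Member i => f s.1 s.2) (by
    rintro r hr
    cases hr with
    | mul i x y z h => simp [← h]
    | ident i j h x y hxy => simp [← hxy, hf])

end Amalgam

/-! ### Amalgams of a given shape -/

namespace Pregeometry

variable {X I : Type*} {𝒢 : Pregeometry X I}

/-- A shape: a set of flags contained in `W` that is closed under passing to larger flags
contained in `W`. -/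
def IsShape (𝒢 : Pregeometry X I) (W : Set X) (𝒲 : Set (Set X)) : Prop :=
  (∀ U ∈ 𝒲, U ⊆ W ∧ 𝒢.IsFlag U) ∧
    ∀ U ∈ 𝒲, ∀ U' ⊆ W, 𝒢.IsFlag U' → U ⊆ U' → U' ∈ 𝒲

/-- The shape of all nonempty flags contained in `W`. -/
def nonemptyFlags (𝒢 : Pregeometry X I) (W : Set X) : Set (Set X) :=
  {U | U ⊆ W ∧ 𝒢.IsFlag U ∧ U.Nonempty}

variable (G : Subgroup 𝒢.Aut)

/-- The parabolic subgroup `G_U`: the elements of `G` fixing each element of `U`. -/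
abbrev parabolic (U : Set X) : Subgroup G := fixingSubgroup G U

/-- For a flag `U`, the parabolic subgroup is the same as the stabilizer of the set `U`. -/
theorem parabolic_eq_stabilizer {U : Set X} (hU : 𝒢.IsFlag U) :
    parabolic G U = MulAction.stabilizer G U := by
  ext g
  rw [mem_fixingSubgroup_iff, MulAction.mem_stabilizer_iff]
  constructor
  · intro h
    ext y
    constructor
    · rintro ⟨x, hx, rfl⟩
      change g • x ∈ U
      rw [h x hx]
      exact hx
    · intro hy
      exact ⟨y, hy, h y hy⟩
  · intro h x hx
    have hgx : g • x ∈ U := h ▸ Set.smul_mem_smul_set hx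
    exact 𝒢.eq_of_inc_of_typ_eq _ _ (hU _ hgx _ hx) (typ_smul G g x)

/-- The amalgam of shape `𝒲`: the family `(G_U)`, `U ∈ 𝒲`, with the natural inclusion maps
`G_U → G_V` for `V ⊆ U` as identifications. -/
def shapeAmalgam (𝒲 : Set (Set X)) : Amalgam where
  Index := 𝒲
  Member U := parabolic G U.1
  Linked U V := V.1 ⊆ U.1
  ident _ _ h := Subgroup.inclusion (fixingSubgroup_antitone G X h)
  ident_injective _ _ _ := Subgroup.inclusion_injective _

/-- The amalgam of parabolics: the family `(G_U)`, where `U` runs over the nonempty flags contained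
in `W`, with the natural inclusion maps. -/
abbrev parabolicAmalgam (W : Set X) : Amalgam := shapeAmalgam G (𝒢.nonemptyFlags W)

/-- The canonical homomorphism from the universal completion of the amalgam of shape `𝒲` to `G`,
which restricts to the inclusion `G_U → G` on each member. -/
def canonicalHom (𝒲 : Set (Set X)) : (shapeAmalgam G 𝒲).UniversalCompletion →* G :=
  (shapeAmalgam G 𝒲).lift (fun U => (parabolic G U.1).subtype) (fun _ _ _ _ => rfl)

end Pregeometry

namespace Pregeometry

/-! ### Cocycles on simply connected pregeometries -/

section Cocycle

variable {Y J : Type*} {Γ : Pregeometry Y J}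

/-! This is Tits' lemma applied to one residue after another. If a group acts on a simply connected
complex with a strict fundamental domain, compatible homomorphisms on the stabilizers of the
domain's vertices extend to the whole group (`IsFundamentalDomain.exists_extension`): the
discrepancies between local choices form a cocycle, which simple connectedness makes a coboundary,
and correcting by it glues the choices. Connectedness alone shows that these stabilizers generate
(`eq_top_of_stabilizer_le`). For a flag `U ⊆ W` outside the shape, `G_U` acts on the residue of `U`
with fundamental domain cut out by `W`, and the stabilizer of `x` is `G_{U ∪ {x}}`. Downward
induction on flags thus maps every `G_U` to the universal completion; generation is proved
alongside, because it makes these maps agree on intersections. At `U = ∅` the map inverts the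
canonical homomorphism. -/

theorem IsConnected.induction (h : Γ.IsConnected) {P : Y → Prop}
    (hstep : ∀ x y, Γ.inc x y → P x → P y) {x : Y} (hx : P x) (y : Y) : P y := by
  obtain ⟨p, hp, hhead, hlast⟩ := h.2 x y
  induction p generalizing x with
  | nil => simp at hhead
  | cons a p ih =>
    obtain rfl : a = x := by simpa using hhead
    cases p with
    | nil =>
      obtain rfl : a = y := by simpa using hlast
      exact hx
    | cons b p =>
      rw [List.isChain_cons_cons] at hp
      exact ih (hstep a b hp.1 hx) hp.2 rfl (by simpa using hlast)

variable {H : Type*} [Group H]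

/-- The product of the values of `c` along the consecutive pairs of a sequence. -/
def pathProd (c : Y → Y → H) : List Y → H
  | [] => 1
  | [_] => 1
  | x :: y :: l => c x y * pathProd c (y :: l)

theorem pathProd_append (c : Y → Y → H) (p q : List Y) (x : Y) :
    pathProd c (p ++ x :: q) = pathProd c (p ++ [x]) * pathProd c (x :: q) := by
  induction p with
  | nil => simp [pathProd]
  | cons a p ih =>
    cases p with
    | nil => simp [pathProd]
    | cons b p =>
      simp only [List.cons_append, pathProd] at ih ⊢
      rw [ih, mul_assoc]

/-- The cocycle condition on the edges of the flag complex. -/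
def IsCocycle (Γ : Pregeometry Y J) (c : Y → Y → H) : Prop :=
  ∀ x y z, Γ.inc x y → Γ.inc y z → Γ.inc x z → c x y * c y z = c x z

theorem IsCocycle.self {c : Y → Y → H} (hc : Γ.IsCocycle c) (x : Y) : c x x = 1 := by
  have h := Γ.inc_refl x
  simpa using hc x x x h h h

/-- Degenerate triples in the cocycle identity give `c x x = 1` and `c x y * c y x = 1`, so every
inserted cycle contributes a trivial factor. -/
theorem IsCocycle.pathProd_eq_of_insertion {c : Y → Y → H} (hc : Γ.IsCocycle c) {p q : List Y}
    (h : Γ.Insertion p q) : pathProd c p = pathProd c q := by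
  cases h with
  | repetition p q x =>
    rw [pathProd_append, pathProd_append c p (_ :: _)]
    simp [pathProd, hc.self]
  | backtrack p q x y hxy =>
    rw [pathProd_append, pathProd_append c p (_ :: _)]
    simp [pathProd, ← mul_assoc, hc x y x hxy (Γ.inc_symm _ _ hxy) (Γ.inc_refl x), hc.self]
  | triangle p q x y z hxy hyz hzx =>
    have hxz := Γ.inc_symm _ _ hzx
    rw [pathProd_append, pathProd_append c p (_ :: _)]
    simp [pathProd, ← mul_assoc, hc x y z hxy hyz hxz, hc x z x hxz hzx (Γ.inc_refl x), hc.self]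

theorem IsCocycle.pathProd_eq_of_homotopic {c : Y → Y → H} (hc : Γ.IsCocycle c) {p q : List Y}
    (h : Γ.Homotopic p q) : pathProd c p = pathProd c q := by
  induction h with
  | rel p q h => exact hc.pathProd_eq_of_insertion h
  | refl => rfl
  | symm _ _ _ ih => exact ih.symm
  | trans _ _ _ _ _ ih₁ ih₂ => exact ih₁.trans ih₂

theorem IsPath.pathProd_append {c : Y → Y → H} {w x y z : Y} {p q : List Y}
    (hp : Γ.IsPath w x p) (hq : Γ.IsPath y z q) :
    pathProd c (p ++ q) = pathProd c p * c x y * pathProd c q := by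
  obtain ⟨p', rfl⟩ := List.getLast?_eq_some_iff.1 hp.2.2
  obtain ⟨q', rfl⟩ := List.head?_eq_some_iff.1 hq.2.1
  rw [List.append_assoc, List.singleton_append, Pregeometry.pathProd_append, pathProd, mul_assoc]

theorem IsPath.append {w x y z : Y} {p q : List Y}
    (hp : Γ.IsPath w x p) (hq : Γ.IsPath y z q) (hxy : Γ.inc x y) :
    Γ.IsPath w z (p ++ q) := by
  refine ⟨hp.1.append hq.1 ?_, ?_, ?_⟩
  · intro a ha b hb
    rw [hp.2.2] at ha
    rw [hq.2.1] at hb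
    obtain rfl : x = a := by simpa using ha
    obtain rfl : y = b := by simpa using hb
    exact hxy
  · simp [List.head?_append, hp.2.1]
  · simp [List.getLast?_append, hq.2.2]

/-- On a simply connected pregeometry every cocycle is a coboundary. -/
theorem IsSimplyConnected.exists_coboundary (hΓ : Γ.IsSimplyConnected) {c : Y → Y → H}
    (hc : Γ.IsCocycle c) : ∃ d : Y → H, ∀ x y, Γ.inc x y → d y = d x * c x y := by
  obtain ⟨⟨x₀⟩, hconn⟩ := hΓ.1
  choose p hp using fun y => hconn x₀ y
  choose q hq using fun y => hconn y x₀
  -- Closing up with the return path `q y` for both edges `(x, y)` and `(y, y)` leaves a common last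
  -- factor, whose cancellation gives the coboundary equation.
  have loop : ∀ x y, Γ.inc x y → pathProd c (p x) * c x y * pathProd c (q y) = 1 := by
    intro x y hxy
    rw [← (hp x).pathProd_append (hq y),
      hc.pathProd_eq_of_homotopic (hΓ.2 x₀ _ ((hp x).append (hq y) hxy)), pathProd]
  refine ⟨fun y => pathProd c (p y), fun x y hxy => ?_⟩
  have h₁ := loop x y hxy
  have h₂ := loop y y (Γ.inc_refl y)
  rw [hc.self, mul_one] at h₂
  exact mul_right_cancel (h₂.trans h₁.symm)

end Cocycle

/-! ### Groups acting on simply connected pregeometries with a fundamental domain -/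

section FundamentalDomain

variable {Y J : Type*} {Γ : Pregeometry Y J} {K : Type*} [Group K] [MulAction K Y]

/-- `T` is a strict fundamental domain for an incidence-preserving action on the 2-skeleton of the
flag complex. -/
structure IsFundamentalDomain (Γ : Pregeometry Y J) (K : Type*) [Group K] [MulAction K Y]
    (T : Set Y) : Prop where
  inc_smul : ∀ (k : K) x y, Γ.inc x y → Γ.inc (k • x) (k • y)
  eq_of_smul_eq : ∀ (k : K), ∀ x ∈ T, ∀ y ∈ T, k • x = y → x = y
  exists_smul_mem : ∀ x y z, Γ.inc x y → Γ.inc y z → Γ.inc x z →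
    ∃ k : K, k • x ∈ T ∧ k • y ∈ T ∧ k • z ∈ T

variable {T : Set Y}

namespace IsFundamentalDomain

/-- Strictness makes `t y`, the representative of the orbit of `y` in `T`, unique. Hence an element
moving a whole triangle into `T` moves each vertex to its representative, and its inverse lifts all
three at once. -/
theorem exists_retraction (hT : Γ.IsFundamentalDomain K T) :
    ∃ t : Y → Y, (∀ y, t y ∈ T) ∧ (∀ (k : K), ∀ x ∈ T, t (k • x) = x) ∧
      ∀ x y z, Γ.inc x y → Γ.inc y z → Γ.inc x z →
        ∃ k : K, k • t x = x ∧ k • t y = y ∧ k • t z = z := by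
  have hvert : ∀ y, ∃ k : K, k • y ∈ T := fun y => by
    obtain ⟨k, h, -⟩ := hT.exists_smul_mem y y y (Γ.inc_refl y) (Γ.inc_refl y) (Γ.inc_refl y)
    exact ⟨k, h⟩
  choose κ hκ using hvert
  have key : ∀ (k : K) y, k • y ∈ T → k⁻¹ • κ y • y = y := by
    intro k y hk
    rw [inv_smul_eq_iff]
    exact hT.eq_of_smul_eq (k * (κ y)⁻¹) _ (hκ y) _ hk (by rw [smul_smul, inv_mul_cancel_right])
  refine ⟨fun y => κ y • y, hκ, fun k x hx => ?_, fun x y z hxy hyz hxz => ?_⟩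
  · have h := key k⁻¹ (k • x) (by rwa [inv_smul_smul])
    rw [inv_inv] at h
    exact MulAction.injective k h
  · obtain ⟨k, hx, hy, hz⟩ := hT.exists_smul_mem x y z hxy hyz hxz
    exact ⟨k⁻¹, key k x hx, key k y hy, key k z hz⟩

/-- The group is generated by the stabilizers of the elements of the fundamental domain. -/
theorem eq_top_of_stabilizer_le (hT : Γ.IsFundamentalDomain K T) (hΓ : Γ.IsConnected)
    (L : Subgroup K) (hL : ∀ x ∈ T, MulAction.stabilizer K x ≤ L) : L = ⊤ := by
  obtain ⟨t, htT, ht, hlift⟩ := hT.exists_retraction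
  obtain ⟨x₀⟩ := hΓ.1
  have hx₀ : t (t x₀) = t x₀ := by simpa using ht 1 _ (htT x₀)
  -- Along an edge from `y` to `z`, a common lift `k` differs from the given `l` by an element of
  -- the stabilizer of `t y`, so `k` also lies in `L`.
  have hall : ∀ y, ∃ l ∈ L, l • t y = y := by
    refine hΓ.induction (x := t x₀) ?_ ⟨1, L.one_mem, by rw [one_smul, hx₀]⟩
    rintro y z hyz ⟨l, hl, hly⟩
    obtain ⟨k, hky, hkz, -⟩ := hlift y z z hyz (Γ.inc_refl z) hyz
    refine ⟨k, ?_, hkz⟩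
    have : l⁻¹ * k ∈ L := hL _ (htT y) (by
      rw [MulAction.mem_stabilizer_iff, mul_smul, hky, inv_smul_eq_iff, hly])
    simpa using L.mul_mem hl this
  rw [eq_top_iff]
  intro g _
  obtain ⟨l, hl, h⟩ := hall (g • t x₀)
  rw [ht g _ (htT x₀)] at h
  have : l⁻¹ * g ∈ L := hL _ (htT x₀) (by
    rw [MulAction.mem_stabilizer_iff, mul_smul, inv_smul_eq_iff, h])
  simpa using L.mul_mem hl this

/-- Homomorphisms on the stabilizers of the elements of the fundamental domain that agree on the
intersections for incident elements extend to the whole group. -/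
theorem exists_extension (hT : Γ.IsFundamentalDomain K T) (hΓ : Γ.IsSimplyConnected)
    {H : Type*} [Group H] (f : Y → K → H)
    (hmul : ∀ x ∈ T, ∀ a b : K, a • x = x → b • x = x → f x (a * b) = f x a * f x b)
    (hagree : ∀ x ∈ T, ∀ y ∈ T, Γ.inc x y → ∀ a : K, a • x = x → a • y = y → f x a = f y a) :
    ∃ φ : K →* H, ∀ x ∈ T, ∀ a : K, a • x = x → φ a = f x a := by
  obtain ⟨t, htT, ht, hlift⟩ := hT.exists_retraction
  have hedge : ∀ x y, Γ.inc x y → ∃ k : K, k • t x = x ∧ k • t y = y := fun x y hxy => by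
    obtain ⟨k, hx, hy, -⟩ := hlift x y y hxy (Γ.inc_refl y) hxy
    exact ⟨k, hx, hy⟩
  have ht_inc : ∀ x y, Γ.inc x y → Γ.inc (t x) (t y) := fun x y hxy => by
    obtain ⟨k, hx, hy⟩ := hedge x y hxy
    rw [← hx, ← hy] at hxy
    simpa [ht _ _ (htT _)] using hT.inc_smul k⁻¹ _ _ hxy
  choose τ hτ using fun y => (hedge y y (Γ.inc_refl y)).imp fun _ h => h.1
  -- When `k` carries `t y` to `y`, it differs from the chosen lift `τ y` by an element stabilizing
  -- `t y`; `e y k` is the image of that difference. Other `k` are irrelevant.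
  let e : Y → K → H := fun y k => f (t y) ((τ y)⁻¹ * k)
  have he : ∀ y (k a : K), k • t y = y → a • t y = t y → e y (k * a) = e y k * f (t y) a := by
    intro y k a hk ha
    simp only [e]
    rw [← mul_assoc]
    exact hmul _ (htT y) _ _ (by rw [mul_smul, hk, inv_smul_eq_iff, hτ]) ha
  -- Two lifts of an edge differ by an element fixing both `t x` and `t y`, where the two
  -- homomorphisms agree, so the quotient does not depend on the lift.
  have hcex : ∀ x y, ∃ c : H, Γ.inc x y →
      ∀ k : K, k • t x = x → k • t y = y → c = e x k * (e y k)⁻¹ := by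
    intro x y
    by_cases hxy : Γ.inc x y
    · obtain ⟨k₀, hx₀, hy₀⟩ := hedge x y hxy
      refine ⟨e x k₀ * (e y k₀)⁻¹, fun _ k hx hy => ?_⟩
      have hax : (k₀⁻¹ * k) • t x = t x := by rw [mul_smul, hx, inv_smul_eq_iff, hx₀]
      have hay : (k₀⁻¹ * k) • t y = t y := by rw [mul_smul, hy, inv_smul_eq_iff, hy₀]
      have hkx := he x k₀ (k₀⁻¹ * k) hx₀ hax
      have hky := he y k₀ (k₀⁻¹ * k) hy₀ hay
      rw [mul_inv_cancel_left] at hkx hky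
      rw [hkx, hky, hagree _ (htT x) _ (htT y) (ht_inc x y hxy) _ hax hay]
      group
    · exact ⟨1, fun h => absurd h hxy⟩
  choose c hc using hcex
  have hcocycle : Γ.IsCocycle c := by
    intro x y z hxy hyz hxz
    obtain ⟨k, hx, hy, hz⟩ := hlift x y z hxy hyz hxz
    rw [hc x y hxy k hx hy, hc y z hyz k hy hz, hc x z hxz k hx hz]
    group
  obtain ⟨d, hd⟩ := hΓ.exists_coboundary hcocycle
  obtain ⟨x₀⟩ := hΓ.1.1
  -- The factor `d` compensates for the transition `c` along edges, so on `T` this value depends on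
  -- `k` only.
  let s : K → Y → H := fun k x => d (k • x) * e (k • x) k
  have hs_const : ∀ (k : K) y, s k (t y) = s k (t x₀) := by
    intro k
    refine hΓ.1.induction ?_ rfl
    rintro x y hxy hx
    rw [← hx]
    have hinc := hT.inc_smul k _ _ (ht_inc x y hxy)
    simp only [s]
    rw [hd _ _ hinc, hc _ _ hinc k (by rw [ht k _ (htT x)]) (by rw [ht k _ (htT y)])]
    group
  have hs_indep : ∀ (k : K), ∀ x ∈ T, s k x = s k (t x₀) := by
    intro k x hx
    have := hs_const k x
    rwa [show t x = x by simpa using ht 1 x hx] at this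
  have hs_mul : ∀ (k : K), ∀ x ∈ T, ∀ a : K, a • x = x →
      s (k * a) (t x₀) = s k (t x₀) * f x a := by
    intro k x hx a ha
    rw [← hs_indep _ x hx, ← hs_indep _ x hx]
    simp only [s]
    rw [mul_smul, ha, he _ k a (by rw [ht k x hx]) (by rw [ht k x hx, ha]), ht k x hx, mul_assoc]
  let φ : K → H := fun k => (s 1 (t x₀))⁻¹ * s k (t x₀)
  have hφ : ∀ (k : K), ∀ x ∈ T, ∀ a : K, a • x = x → φ (k * a) = φ k * f x a :=
    fun k x hx a ha => (congrArg _ (hs_mul k x hx a ha)).trans (mul_assoc _ _ _).symm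
  have hφ_one : φ 1 = 1 := by simp [φ]
  have hφ_stab : ∀ x ∈ T, ∀ a : K, a • x = x → φ a = f x a := fun x hx a ha => by
    simpa [hφ_one] using hφ 1 x hx a ha
  -- So far `φ` is multiplicative only when the right factor stabilizes a point of `T`. The
  -- admissible right factors form a subgroup, hence everything.
  let L : Subgroup K :=
    { carrier := {g | ∀ k, φ (k * g) = φ k * φ g}
      one_mem' := fun k => by simp [hφ_one]
      mul_mem' := fun {a b} ha hb k => by
        rw [← mul_assoc, hb, ha, hb a, mul_assoc]
      inv_mem' := fun {a} ha k => by
        have h₁ := ha (k * a⁻¹)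
        have h₂ := ha a⁻¹
        rw [inv_mul_cancel_right] at h₁
        rw [inv_mul_cancel, hφ_one] at h₂
        rw [h₁, eq_inv_of_mul_eq_one_left h₂.symm, mul_inv_cancel_right] }
  have hL : L = ⊤ := hT.eq_top_of_stabilizer_le hΓ.1 L fun x hx a ha k => by
    rw [hφ k x hx a ha, hφ_stab x hx a ha]
  refine ⟨MonoidHom.mk' φ fun a b => ?_, hφ_stab⟩
  have : b ∈ L := hL ▸ Subgroup.mem_top b
  exact this a

end IsFundamentalDomain

end FundamentalDomain

/-! ### The action of a parabolic subgroup on a residue -/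

section Residue

variable {X I : Type*} {𝒢 : Pregeometry X I} {G : Subgroup 𝒢.Aut} {W : Set X}

theorem inc_smul_iff (g : G) (x y : X) : 𝒢.inc (g • x) (g • y) ↔ 𝒢.inc x y :=
  (g : 𝒢.Aut).2.2 x y

theorem isFlag_insert_iff {F : Set X} {x : X} :
    𝒢.IsFlag (insert x F) ↔ 𝒢.IsFlag F ∧ ∀ y ∈ F, 𝒢.inc x y := by
  constructor
  · exact fun h => ⟨fun a ha b hb => h a (.inr ha) b (.inr hb),
      fun y hy => h x (.inl rfl) y (.inr hy)⟩
  · rintro ⟨hF, hx⟩ a (rfl | ha) b (rfl | hb)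
    · exact 𝒢.inc_refl _
    · exact hx b hb
    · exact 𝒢.inc_symm _ _ (hx a ha)
    · exact hF a ha b hb

theorem mem_residueElements_iff {U : Set X} {x : X} :
    x ∈ 𝒢.residueElements U ↔ 𝒢.typ x ∉ 𝒢.typ '' U ∧ 𝒢.IsFlag (insert x U) :=
  ⟨fun h => ⟨h.1.1, h.2⟩, fun h => ⟨⟨h.1, x, rfl, h.2⟩, h.2⟩⟩

theorem smul_mem_residueElements {U : Set X} {g : G} (hg : g ∈ parabolic G U) {x : X}
    (hx : x ∈ 𝒢.residueElements U) : g • x ∈ 𝒢.residueElements U := by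
  rw [mem_residueElements_iff, isFlag_insert_iff] at hx ⊢
  refine ⟨by rw [typ_smul]; exact hx.1, hx.2.1, fun y hy => ?_⟩
  have hgy : g • y = y := (mem_fixingSubgroup_iff G).1 hg y hy
  rw [← hgy, inc_smul_iff]
  exact hx.2.2 y hy

instance residueMulAction (U : Set X) : MulAction (parabolic G U) (𝒢.residueElements U) where
  smul g x := ⟨(g : G) • (x : X), smul_mem_residueElements g.2 x.2⟩
  one_smul x := Subtype.ext (one_smul G (x : X))
  mul_smul g h x := Subtype.ext (mul_smul (g : G) (h : G) (x : X))

theorem mem_parabolic_insert {U : Set X} {x : X} {g : G} :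
    g ∈ parabolic G (insert x U) ↔ g • x = x ∧ g ∈ parabolic G U := by
  simp [mem_fixingSubgroup_iff]

/-- An element of `G` carries a given flag into the set `W` of representatives. -/
theorem exists_smul_mem_representatives (hrep : IsOrbitRepresentatives G W) (hhall : 𝒢.IsHall W)
    (htrans : ∀ V ⊆ W, 𝒢.IsFlag V → (orbitGeometry G V).IsFlagTransitive G)
    {F : Set X} (hF : 𝒢.IsFlag F) : ∃ g : G, ∀ x ∈ F, g • x ∈ W := by
  choose r hr _ using hrep
  have htyp : ∀ x, 𝒢.typ (r x) = 𝒢.typ x := by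
    intro x
    obtain ⟨g, hg⟩ := (hr x).2
    rw [← hg]
    exact typ_smul G g x
  have hVW : r '' F ⊆ W := by
    rintro _ ⟨x, _, rfl⟩
    exact (hr x).1
  have hV : 𝒢.IsFlag (r '' F) := by
    refine hhall.1 _ hVW ?_
    rintro _ ⟨x, hx, rfl⟩ _ ⟨y, hy, rfl⟩ h
    rw [htyp, htyp] at h
    rw [𝒢.eq_of_inc_of_typ_eq x y (hF x hx y hy) h]
  have hmem : ∀ x ∈ F, x ∈ orbitElements G (r '' F) := fun x hx =>
    ⟨r x, ⟨x, hx, rfl⟩, MulAction.mem_orbit_symm.1 (hr x).2⟩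
  have hmem' : ∀ x ∈ F, r x ∈ orbitElements G (r '' F) := fun x hx =>
    ⟨r x, ⟨x, hx, rfl⟩, MulAction.mem_orbit_self _⟩
  -- `F` and its set of representatives are flags of the same type in one orbit geometry.
  obtain ⟨g, hg⟩ := htrans (r '' F) hVW hV {x | (x : X) ∈ F} {x | (x : X) ∈ r '' F}
    (fun x hx y hy => hF x hx y hy) (fun x hx y hy => hV x hx y hy) (by
      ext j
      constructor
      · rintro ⟨x, hx, rfl⟩
        exact ⟨⟨r x, hmem' x hx⟩, ⟨x, hx, rfl⟩, Subtype.ext (htyp x)⟩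
      · rintro ⟨⟨_, hy⟩, ⟨x, hx, rfl⟩, rfl⟩
        exact ⟨⟨x, hmem x hx⟩, hx, Subtype.ext (htyp x).symm⟩)
  refine ⟨g, fun x hx => ?_⟩
  have : g • (⟨x, hmem x hx⟩ : orbitElements G (r '' F)) ∈
      {x : orbitElements G (r '' F) | (x : X) ∈ r '' F} :=
    hg ▸ Set.smul_mem_smul_set (show (⟨x, hmem x hx⟩ : orbitElements G (r '' F)) ∈
      {y : orbitElements G (r '' F) | (y : X) ∈ F} from hx)
  exact hVW this

theorem IsOrbitRepresentatives.eq_of_smul_eq (hrep : IsOrbitRepresentatives G W) {x y : X}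
    (hx : x ∈ W) (hy : y ∈ W) {g : G} (h : g • x = y) : x = y :=
  (hrep x).unique ⟨hx, MulAction.mem_orbit_self x⟩ ⟨hy, g, h⟩

/-- A triangle of the residue together with `U` is a flag, so one `g` moves it into `W`. As `U`
already lies in `W`, which meets each orbit once, `g` fixes `U` pointwise. -/
theorem isFundamentalDomain_residue (hrep : IsOrbitRepresentatives G W) (hhall : 𝒢.IsHall W)
    (htrans : ∀ V ⊆ W, 𝒢.IsFlag V → (orbitGeometry G V).IsFlagTransitive G)
    {U : Set X} (hUW : U ⊆ W) :
    (𝒢.residue U).IsFundamentalDomain (parabolic G U) {x | (x : X) ∈ W} where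
  inc_smul k x y h := (inc_smul_iff (k : G) (x : X) (y : X)).2 h
  eq_of_smul_eq k x hx y hy h :=
    Subtype.ext (hrep.eq_of_smul_eq hx hy (congrArg Subtype.val h))
  exists_smul_mem := by
    rintro ⟨x, hx⟩ ⟨y, hy⟩ ⟨z, hz⟩ (hxy : 𝒢.inc x y) (hyz : 𝒢.inc y z) (hxz : 𝒢.inc x z)
    have hx' := isFlag_insert_iff.1 hx.2
    have hy' := isFlag_insert_iff.1 hy.2
    have hz' := isFlag_insert_iff.1 hz.2
    have hF : 𝒢.IsFlag (insert x (insert y (insert z U))) := by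
      simp only [isFlag_insert_iff, Set.forall_mem_insert]
      exact ⟨⟨hz', hyz, hy'.2⟩, hxy, hxz, hx'.2⟩
    obtain ⟨g, hg⟩ := exists_smul_mem_representatives hrep hhall htrans hF
    have hgU : g ∈ parabolic G U := by
      rw [mem_fixingSubgroup_iff]
      intro u hu
      exact (hrep.eq_of_smul_eq (hUW hu) (hg u (by simp [hu])) rfl).symm
    exact ⟨⟨g, hgU⟩, hg x (by simp), hg y (by simp), hg z (by simp)⟩

end Residue

/-! ### Amalgams of parabolic subgroups -/

section Amalgam

variable {X I : Type*} {𝒢 : Pregeometry X I} {G : Subgroup 𝒢.Aut} {W : Set X} {𝒲 : Set (Set X)}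

/-- The universal completion map restricted to a member, as a homomorphism. -/
def memberHom (A : Amalgam) (i : A.Index) : A.Member i →* A.UniversalCompletion :=
  MonoidHom.mk' (A.of i) fun x y => by
    have h : A.of i x * A.of i y * (A.of i (x * y))⁻¹ = 1 :=
      PresentedGroup.one_of_mem (Amalgam.IsRelator.mul i x y _ rfl)
    exact (mul_inv_eq_one.1 h).symm

theorem of_ident (A : Amalgam) (i j : A.Index) (h : A.Linked i j) (x : A.Member i) :
    A.of j (A.ident i j h x) = A.of i x :=
  (mul_inv_eq_one.1 (PresentedGroup.one_of_mem (Amalgam.IsRelator.ident i j h x _ rfl))).symm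

theorem lift_of (A : Amalgam) {H : Type*} [Group H] (f : ∀ i, A.Member i →* H)
    (hf : ∀ i j (h : A.Linked i j) (x : A.Member i), f j (A.ident i j h x) = f i x)
    (i : A.Index) (x : A.Member i) : A.lift f hf (A.of i x) = f i x := by
  unfold Amalgam.lift Amalgam.of
  exact PresentedGroup.toGroup.of _

theorem canonicalHom_of {U : Set X} (hU : U ∈ 𝒲) (g : parabolic G U) :
    canonicalHom G 𝒲 ((shapeAmalgam G 𝒲).of ⟨U, hU⟩ g) = g :=
  lift_of (shapeAmalgam G 𝒲) (fun U => (parabolic G U.1).subtype) (fun _ _ _ _ => rfl) ⟨U, hU⟩ g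

/-- The parabolic subgroup of `U` is generated by those of the members of `𝒲` above `U`. -/
def IsGeneratedAbove (G : Subgroup 𝒢.Aut) (𝒲 : Set (Set X)) (U : Set X) : Prop :=
  ∀ L : Subgroup G, (∀ V ∈ 𝒲, U ⊆ V → parabolic G V ≤ L) → parabolic G U ≤ L

/-- `ψ` is compatible with the maps from the members of the amalgam above `U`. -/
def IsCompatible {U : Set X} (ψ : parabolic G U →* (shapeAmalgam G 𝒲).UniversalCompletion) :
    Prop :=
  ∀ (V : Set X) (hV : V ∈ 𝒲) (hUV : U ⊆ V) (g : parabolic G V),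
    ψ (Subgroup.inclusion (fixingSubgroup_antitone G X hUV) g) = (shapeAmalgam G 𝒲).of ⟨V, hV⟩ g

/-- Compatibility prescribes both maps on the members above `U'`, and these generate `G_{U'}`. -/
theorem IsCompatible.eq_on {U V U' : Set X}
    {ψ : parabolic G U →* (shapeAmalgam G 𝒲).UniversalCompletion}
    {χ : parabolic G V →* (shapeAmalgam G 𝒲).UniversalCompletion}
    (hψ : IsCompatible ψ) (hχ : IsCompatible χ) (hU : U ⊆ U') (hV : V ⊆ U')
    (hgen : IsGeneratedAbove G 𝒲 U') {g : G} (hg : g ∈ parabolic G U') :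
    ψ ⟨g, fixingSubgroup_antitone G X hU hg⟩ = χ ⟨g, fixingSubgroup_antitone G X hV hg⟩ := by
  let ψ' := ψ.comp (Subgroup.inclusion (fixingSubgroup_antitone G X hU))
  let χ' := χ.comp (Subgroup.inclusion (fixingSubgroup_antitone G X hV))
  have h := hgen ((ψ'.eqLocus χ').map (parabolic G U').subtype) (by
    intro S hS hUS k hk
    refine ⟨⟨k, fixingSubgroup_antitone G X hUS hk⟩, ?_, rfl⟩
    exact (hψ S hS (hU.trans hUS) ⟨k, hk⟩).trans (hχ S hS (hV.trans hUS) ⟨k, hk⟩).symm)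
  obtain ⟨k, hk, rfl⟩ := h hg
  exact hk

/-- For each flag contained in `W`, the parabolic subgroup is generated by the members of the
amalgam above it and maps compatibly to the universal completion. -/
theorem isGeneratedAbove_and_exists_isCompatible [Finite I]
    (hrep : IsOrbitRepresentatives G W) (hhall : 𝒢.IsHall W)
    (htrans : ∀ V ⊆ W, 𝒢.IsFlag V → (orbitGeometry G V).IsFlagTransitive G)
    (hshape : 𝒢.IsShape W 𝒲)
    (hres : ∀ U ⊆ W, 𝒢.IsFlag U → U ∉ 𝒲 → (𝒢.residue U).IsSimplyConnected)
    {U : Set X} (hUW : U ⊆ W) (hU : 𝒢.IsFlag U) :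
    IsGeneratedAbove G 𝒲 U ∧
      ∃ ψ : parabolic G U →* (shapeAmalgam G 𝒲).UniversalCompletion, IsCompatible ψ := by
  classical
  -- Types, unlike elements, are finite in number, and each added residue element brings a new type.
  -- Chambers need no separate case: their empty residue is not connected, so they must lie in `𝒲`.
  induction hS : 𝒢.typ '' U using WellFoundedGT.induction generalizing U with
  | ind S ih =>
    subst hS
    by_cases hU𝒲 : U ∈ 𝒲
    · exact ⟨fun L hL => hL U hU𝒲 subset_rfl, memberHom (shapeAmalgam G 𝒲) ⟨U, hU𝒲⟩,
        fun V hV hUV g => of_ident (shapeAmalgam G 𝒲) ⟨V, hV⟩ ⟨U, hU𝒲⟩ hUV g⟩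
    have hsc := hres U hUW hU hU𝒲
    have hdom := isFundamentalDomain_residue hrep hhall htrans hUW
    have step : ∀ U', U ⊆ U' → U' ⊆ W → 𝒢.IsFlag U' → ∀ x ∈ U', 𝒢.typ x ∉ 𝒢.typ '' U →
        IsGeneratedAbove G 𝒲 U' ∧
          ∃ ψ : parabolic G U' →* (shapeAmalgam G 𝒲).UniversalCompletion, IsCompatible ψ :=
      fun U' hUU' hU'W hU' x hx hxU => ih (𝒢.typ '' U')
        ⟨Set.image_mono hUU', fun h => hxU (h ⟨x, hx, rfl⟩)⟩ hU'W hU' rfl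
    have step₁ : ∀ x : 𝒢.residueElements U, (x : X) ∈ W →
        IsGeneratedAbove G 𝒲 (insert (x : X) U) ∧
          ∃ ψ : parabolic G (insert (x : X) U) →* (shapeAmalgam G 𝒲).UniversalCompletion,
            IsCompatible ψ :=
      fun x hx => step _ (Set.subset_insert _ _) (Set.insert_subset hx hUW) x.2.2 x
        (Set.mem_insert _ _) x.2.1.1
    -- Since `U ∉ 𝒲`, such a `V` properly contains `U`; `G_V` then lies in the stabilizer of some
    -- `x`, through which generation and compatibility can be tested.
    have exists_above : ∀ V ∈ 𝒲, U ⊆ V →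
        ∃ x : 𝒢.residueElements U, (x : X) ∈ W ∧ insert (x : X) U ⊆ V := by
      intro V hV hUV
      obtain ⟨x, hxV, hxU⟩ := Set.exists_of_ssubset
        (hUV.ssubset_of_ne fun h => hU𝒲 (h ▸ hV))
      have hVflag := (hshape.1 V hV).2
      have hsub : insert x U ⊆ V := Set.insert_subset hxV hUV
      refine ⟨⟨x, mem_residueElements_iff.2 ⟨?_, fun a ha b hb => hVflag a (hsub ha) b (hsub hb)⟩⟩,
        (hshape.1 V hV).1 hxV, hsub⟩
      rintro ⟨u, hu, h⟩
      exact hxU (𝒢.eq_of_inc_of_typ_eq u x (hVflag u (hUV hu) x hxV) h ▸ hu)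
    refine ⟨fun L hL => ?_, ?_⟩
    · have := hdom.eq_top_of_stabilizer_le hsc.1 (L.subgroupOf (parabolic G U)) (by
        intro x hx a ha
        rw [Subgroup.mem_subgroupOf]
        refine (step₁ x hx).1 L
          (fun V hV hxV => hL V hV ((Set.subset_insert _ _).trans hxV)) ?_
        exact mem_parabolic_insert.2 ⟨congrArg Subtype.val ha, a.2⟩)
      exact Subgroup.subgroupOf_eq_top.1 this
    · choose! ψ hψ using fun x hx => (step₁ x hx).2
      have hmem : ∀ (x : 𝒢.residueElements U) (a : parabolic G U), a • x = x →
          (a : G) ∈ parabolic G (insert (x : X) U) :=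
        fun x a ha => mem_parabolic_insert.2 ⟨congrArg Subtype.val ha, a.2⟩
      -- The default `1` off the stabilizer of `x` is never used.
      let f : 𝒢.residueElements U → parabolic G U → (shapeAmalgam G 𝒲).UniversalCompletion :=
        fun x a => if h : a • x = x then ψ x ⟨a, hmem x a h⟩ else 1
      have hf : ∀ x a (h : a • x = x), f x a = ψ x ⟨a, hmem x a h⟩ := fun x a h => dif_pos h
      obtain ⟨φ, hφ⟩ := hdom.exists_extension hsc f
        (by
          intro x hx a b ha hb
          rw [hf x a ha, hf x b hb, hf x (a * b) (by rw [mul_smul, hb, ha]), ← map_mul]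
          rfl)
        (by
          intro x hx y hy hxy a ha hb
          rw [hf x a ha, hf y a hb]
          have hflag : 𝒢.IsFlag (insert (x : X) (insert (y : X) U)) := by
            simp only [isFlag_insert_iff, Set.forall_mem_insert]
            exact ⟨isFlag_insert_iff.1 y.2.2, hxy, (isFlag_insert_iff.1 x.2.2).2⟩
          have hsubx : insert (x : X) U ⊆ insert (x : X) (insert (y : X) U) :=
            Set.insert_subset_insert (Set.subset_insert _ _)
          have hgen := (step (insert (x : X) (insert (y : X) U))
            ((Set.subset_insert _ _).trans hsubx)
            (Set.insert_subset hx (Set.insert_subset hy hUW)) hflag x (Set.mem_insert _ _)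
            x.2.1.1).1
          exact (hψ x hx).eq_on (hψ y hy) hsubx (Set.subset_insert _ _) hgen
            (mem_parabolic_insert.2 ⟨congrArg Subtype.val ha, hmem y a hb⟩))
      refine ⟨φ, fun V hV hUV g => ?_⟩
      obtain ⟨x, hxW, hxV⟩ := exists_above V hV hUV
      have hgx : (g : G) ∈ parabolic G (insert (x : X) U) := fixingSubgroup_antitone G X hxV g.2
      have hfix : Subgroup.inclusion (fixingSubgroup_antitone G X hUV) g • x = x :=
        Subtype.ext (mem_parabolic_insert.1 hgx).1
      rw [hφ x hxW _ hfix, hf x _ hfix]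
      exact hψ x hxW V hV hxV g

/-- At `U = ∅`, where `G_∅ = G`, the compatible map is a left inverse, and generation gives
surjectivity. -/
theorem canonicalHom_bijective [Finite I]
    (hrep : IsOrbitRepresentatives G W) (hhall : 𝒢.IsHall W)
    (htrans : ∀ V ⊆ W, 𝒢.IsFlag V → (orbitGeometry G V).IsFlagTransitive G)
    (hshape : 𝒢.IsShape W 𝒲)
    (hres : ∀ U ⊆ W, 𝒢.IsFlag U → U ∉ 𝒲 → (𝒢.residue U).IsSimplyConnected) :
    Function.Bijective (canonicalHom G 𝒲) := by
  obtain ⟨hgen, ψ, hψ⟩ := isGeneratedAbove_and_exists_isCompatible hrep hhall htrans hshape hres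
    (Set.empty_subset W) (fun x hx => hx.elim)
  have hmem : ∀ g : G, g ∈ parabolic G (∅ : Set X) := fun g => by simp
  constructor
  · let χ : G →* (shapeAmalgam G 𝒲).UniversalCompletion := ψ.comp
      ((MonoidHom.id G).codRestrict (parabolic G (∅ : Set X)) hmem)
    have : χ.comp (canonicalHom G 𝒲) = MonoidHom.id _ := by
      refine PresentedGroup.ext ?_
      rintro ⟨⟨U, hU⟩, g⟩
      have h : χ (canonicalHom G 𝒲 ((shapeAmalgam G 𝒲).of ⟨U, hU⟩ g)) =
          (shapeAmalgam G 𝒲).of ⟨U, hU⟩ g := by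
        exact (congrArg χ (canonicalHom_of hU g)).trans (hψ U hU (Set.empty_subset U) g)
      exact h
    exact Function.LeftInverse.injective (g := χ) fun u => DFunLike.congr_fun this u
  · intro g
    exact hgen (canonicalHom G 𝒲).range
      (fun V hV _ k hk => ⟨(shapeAmalgam G 𝒲).of ⟨V, hV⟩ ⟨k, hk⟩, canonicalHom_of hV ⟨k, hk⟩⟩)
      (hmem g)

theorem isShape_nonemptyFlags (𝒢 : Pregeometry X I) (W : Set X) :
    𝒢.IsShape W (𝒢.nonemptyFlags W) :=
  ⟨fun _ hU => ⟨hU.1, hU.2.1⟩, fun _ hU _ hU'W hU' h => ⟨hU'W, hU', hU.2.2.mono h⟩⟩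

end Amalgam

end Pregeometry

theorem theorem3p3 {X I : Type*} [Finite I] (𝒢 : Pregeometry X I) (h𝒢 : 𝒢.IsGeometry)
    (G : Subgroup 𝒢.Aut) (W : Set X)
    (hrep : Pregeometry.IsOrbitRepresentatives G W)
    (hhall : 𝒢.IsHall W)
    (htrans : ∀ V ⊆ W, 𝒢.IsFlag V → (Pregeometry.orbitGeometry G V).IsFlagTransitive G)
    (𝒲 : Set (Set X)) (hshape : 𝒢.IsShape W 𝒲)
    (hres : ∀ U ⊆ W, 𝒢.IsFlag U → U ∉ 𝒲 → (𝒢.residue U).IsSimplyConnected) :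
    Function.Bijective (Pregeometry.canonicalHom G 𝒲) ∧
      (∅ ∉ 𝒲 →
        Function.Bijective (Pregeometry.canonicalHom G (𝒢.nonemptyFlags W)) ∧
        ∃ e : (Pregeometry.shapeAmalgam G 𝒲).UniversalCompletion ≃*
            (Pregeometry.parabolicAmalgam G W).UniversalCompletion,
          ∀ (U : Set X) (hU : U ∈ 𝒲) (hU' : U ∈ 𝒢.nonemptyFlags W)
            (g : Pregeometry.parabolic G U),
            e ((Pregeometry.shapeAmalgam G 𝒲).of ⟨U, hU⟩ g) =
              (Pregeometry.parabolicAmalgam G W).of ⟨U, hU'⟩ g) := by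
  have hbij := Pregeometry.canonicalHom_bijective hrep hhall htrans hshape hres
  refine ⟨hbij, fun hempty => ?_⟩
  have hbij' : Function.Bijective (Pregeometry.canonicalHom G (𝒢.nonemptyFlags W)) := by
    -- Here only `∅` lies outside the shape, and its residue is simply connected because `∅ ∉ 𝒲`.
    refine Pregeometry.canonicalHom_bijective hrep hhall htrans
      (Pregeometry.isShape_nonemptyFlags 𝒢 W) fun U hUW hU hU' => ?_
    obtain rfl : U = ∅ := by
      by_contra hne
      exact hU' ⟨hUW, hU, Set.nonempty_iff_ne_empty.2 hne⟩
    exact hres ∅ hUW hU hempty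
  refine ⟨hbij', (MulEquiv.ofBijective _ hbij).trans (MulEquiv.ofBijective _ hbij').symm,
    fun U hU hU' g => ?_⟩
  rw [MulEquiv.trans_apply, MulEquiv.symm_apply_eq]
  exact (Pregeometry.canonicalHom_of hU g).trans (Pregeometry.canonicalHom_of hU' g).symm
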